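/- Conventions. Let $A$ be a ring with unit and $\mathfrak C$ an $A$-coring with comultiplication $\Delta$ and counit $\varepsilon$. A (not necessarily unital) ring $R$ is firm if the multiplication map $R\otimes_R R\to R$ is bijective, and a left $R$-module $N$ is firm if $R\otimes_R N\to N$, $r\otimes n\mapsto rn$, is bijective. For a firm ring $R$, ${}_R\mathcal M^{\mathfrak C}$ denotes the category of right $\mathfrak C$-comodules $(\Sigma,\rho)$, $\rho(u)=u_{[0]}\otimes_A u_{[1]}$, that are also firm left $R$-modules such that $\Sigma$ is an $R$-$A$-bimodule and $\rho$ is left $R$-linear. Such a $\Sigma$ is called *$R$-$\mathfrak C$ comonadic-Galois* if for every right $A$-module $M$ the map $$\mathsf{can}_M:\mathrm{Hom}_A(\Sigma,M)\otimes_R\Sigma\to M\otimes_A\mathfrak C,\qquad \mathsf{can}_M(f\otimes_R u)=f(u_{[0]})\otimes_A u_{[1]},$$ is an isomorphism, where $R$ acts on $\mathrm{Hom}_A(\Sigma,M)$ by $(fr)(u)=f(ru)$. Theorem. Let $\mathfrak C$ be an $A$-coring, $R$ a firm ring and $\Sigma\in{}_R\mathcal M^{\mathfrak C}$. Let $T=\mathrm{End}^{\mathfrak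 C}(\Sigma)$ be the unital ring of right $\mathfrak C$-colinear endomorphisms of $\Sigma$, with composition as multiplication, so that $\Sigma\in{}_T\mathcal M^{\mathfrak C}$, and let $\jmath:R\to T$, $\jmath(r)(u)=ru$, be the canonical ring morphism. (i) If $\Sigma$ is $R$-$\mathfrak C$ comonadic-Galois, then $\Sigma$ is $T$-$\mathfrak C$ comonadic-Galois (i.e. a Galois comodule in the sense of Wisbauer). (ii) If $R$ is a left ideal in $T$ (that is, $\jmath(R)$ is a left ideal of $T$) and $\Sigma$ is $T$-$\mathfrak C$ comonadic-Galois, then $\Sigma$ is $R$-$\mathfrak C$ comonadic-Galois; hence, when $R$ is a left ideal in $T$, the two properties are equivalent. -/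

import Mathlib

open MulOpposite

universe u

/-! ## Tensor products over a (possibly non-unital, non-commutative) ring -/

/-- The tensor product `M ⊗_R N` of a right `R`-module `M` and a left `R`-module `N`: the quotient
of `M ⊗_ℤ N` by the subgroup generated by all `(m r) ⊗ n - m ⊗ (r n)`. A right action of `R` is
written as an action of `Rᵐᵒᵖ`. -/
def BT (R M N : Type u) [AddCommGroup M] [AddCommGroup N] [SMul Rᵐᵒᵖ M] [SMul R N] : Type u :=
  TensorProduct ℤ M N ⧸ AddSubgroup.closure
    {x : TensorProduct ℤ M N | ∃ (m : M) (r : R) (n : N),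
      x = TensorProduct.tmul ℤ (op r • m) n - TensorProduct.tmul ℤ m (r • n)}

namespace BT

section Basic

variable (R : Type u) {M N M' N' Q : Type u} [AddCommGroup M] [AddCommGroup N] [AddCommGroup M']
  [AddCommGroup N'] [AddCommGroup Q] [SMul Rᵐᵒᵖ M] [SMul R N] [SMul Rᵐᵒᵖ M'] [SMul R N']

instance : AddCommGroup (BT R M N) :=
  inferInstanceAs (AddCommGroup (TensorProduct ℤ M N ⧸ AddSubgroup.closure
    {x : TensorProduct ℤ M N | ∃ (m : M) (r : R) (n : N),
      x = TensorProduct.tmul ℤ (op r • m) n - TensorProduct.tmul ℤ m (r • n)}))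

/-- The pure tensor `m ⊗_R n`. -/
def tmul (m : M) (n : N) : BT R M N :=
  QuotientAddGroup.mk (TensorProduct.tmul ℤ m n)

/-- The additive map on `M ⊗_R N` induced by an `R`-balanced biadditive map. -/
def lift (f : M →+ N →+ Q) (hf : ∀ (m : M) (r : R) (n : N), f (op r • m) n = f m (r • n)) :
    BT R M N →+ Q :=
  QuotientAddGroup.lift _
    (TensorProduct.liftAddHom f (fun z m n => by simp))
    (by
      rw [AddSubgroup.closure_le]
      rintro _ ⟨m, r, n, rfl⟩
      simp [hf])

@[simp] theorem lift_tmul (f : M →+ N →+ Q)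
    (hf : ∀ (m : M) (r : R) (n : N), f (op r • m) n = f m (r • n)) (m : M) (n : N) :
    lift R f hf (tmul R m n) = f m n := rfl

theorem add_tmul (m m' : M) (n : N) : tmul R (m + m') n = tmul R m n + tmul R m' n :=
  congrArg QuotientAddGroup.mk (TensorProduct.add_tmul m m' n)

theorem tmul_add (m : M) (n n' : N) : tmul R m (n + n') = tmul R m n + tmul R m n' :=
  congrArg QuotientAddGroup.mk (TensorProduct.tmul_add m n n')

theorem smul_tmul (m : M) (r : R) (n : N) : tmul R (op r • m) n = tmul R m (r • n) := by
  apply Eq.symm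
  refine QuotientAddGroup.eq.2 ?_
  refine AddSubgroup.subset_closure ⟨m, r, n, ?_⟩
  abel

/-- The biadditive map `(m, n) ↦ m ⊗_R n`. -/
def mk : M →+ N →+ BT R M N :=
  AddMonoidHom.mk' (fun m => AddMonoidHom.mk' (fun n => tmul R m n) (tmul_add R m))
    (fun m m' => by ext n; exact add_tmul R m m' n)

@[simp] theorem mk_apply (m : M) (n : N) : mk R m n = tmul R m n := rfl

@[elab_as_elim]
theorem induction {p : BT R M N → Prop} (x : BT R M N) (zero : p 0)
    (tmul : ∀ m n, p (tmul R m n)) (add : ∀ x y, p x → p y → p (x + y)) : p x := by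
  refine QuotientAddGroup.induction_on x fun x => ?_
  induction x using TensorProduct.induction_on with
  | zero => exact zero
  | tmul m n => exact tmul m n
  | add x y hx hy => exact add _ _ hx hy

/-- `f ⊗_R g : M ⊗_R N → M' ⊗_R N'` for a right `R`-linear `f` and a left `R`-linear `g`. -/
def map (f : M →+ M') (g : N →+ N') (hf : ∀ (r : R) (m : M), f (op r • m) = op r • f m)
    (hg : ∀ (r : R) (n : N), g (r • n) = r • g n) : BT R M N →+ BT R M' N' :=
  lift R (((mk R).comp f).compl₂ g)
    (fun m r n => by simp [hf, hg, smul_tmul])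

@[simp] theorem map_tmul (f : M →+ M') (g : N →+ N')
    (hf : ∀ (r : R) (m : M), f (op r • m) = op r • f m)
    (hg : ∀ (r : R) (n : N), g (r • n) = r • g n) (m : M) (n : N) :
    map R f g hf hg (tmul R m n) = tmul R (f m) (g n) := rfl

end Basic

section Right

variable {R B M N : Type u} [Ring B] [AddCommGroup M] [AddCommGroup N] [SMul Rᵐᵒᵖ M] [SMul R N]
  [Module Bᵐᵒᵖ N] [SMulCommClass R Bᵐᵒᵖ N]

/-- If `N` is an `R`-`B`-bimodule then `B` acts on `M ⊗_R N` from the right, through `N`. -/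
instance rightSMul : SMul Bᵐᵒᵖ (BT R M N) where
  smul b := map R (AddMonoidHom.id M) (DistribSMul.toAddMonoidHom N b) (fun _ _ => rfl)
    (fun r n => (smul_comm r b n).symm)

@[simp] theorem right_smul_tmul (b : Bᵐᵒᵖ) (m : M) (n : N) :
    b • tmul R m n = tmul R m (b • n) := rfl

instance rightModule : Module Bᵐᵒᵖ (BT R M N) where
  smul_zero b := map_zero (map R (AddMonoidHom.id M) (DistribSMul.toAddMonoidHom N b) _ _)
  smul_add b := map_add (map R (AddMonoidHom.id M) (DistribSMul.toAddMonoidHom N b) _ _)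
  one_smul x := by
    induction x using BT.induction with
    | zero => exact map_zero (map R (AddMonoidHom.id M) (DistribSMul.toAddMonoidHom N 1) _ _)
    | tmul m n => rw [right_smul_tmul, one_smul]
    | add x y hx hy =>
      exact (map_add (map R (AddMonoidHom.id M) (DistribSMul.toAddMonoidHom N 1) _ _) x y).trans
        (congrArg₂ (· + ·) hx hy)
  mul_smul b c x := by
    have h (d : Bᵐᵒᵖ) (x y : BT R M N) : d • (x + y) = d • x + d • y :=
      map_add (map R (AddMonoidHom.id M) (DistribSMul.toAddMonoidHom N d) _ _) x y
    have h0 (d : Bᵐᵒᵖ) : d • (0 : BT R M N) = 0 :=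
      map_zero (map R (AddMonoidHom.id M) (DistribSMul.toAddMonoidHom N d) _ _)
    induction x using BT.induction with
    | zero => simp only [h0]
    | tmul m n => simp only [right_smul_tmul, mul_smul]
    | add x y hx hy => simp only [h, hx, hy]
  add_smul b c x := by
    have h (d : Bᵐᵒᵖ) (x y : BT R M N) : d • (x + y) = d • x + d • y :=
      map_add (map R (AddMonoidHom.id M) (DistribSMul.toAddMonoidHom N d) _ _) x y
    have h0 (d : Bᵐᵒᵖ) : d • (0 : BT R M N) = 0 :=
      map_zero (map R (AddMonoidHom.id M) (DistribSMul.toAddMonoidHom N d) _ _)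
    induction x using BT.induction with
    | zero => simp only [h0, add_zero]
    | tmul m n => simp only [right_smul_tmul, add_smul, tmul_add]
    | add x y hx hy => rw [h, h, h, hx, hy]; abel
  zero_smul x := by
    have h (d : Bᵐᵒᵖ) (x y : BT R M N) : d • (x + y) = d • x + d • y :=
      map_add (map R (AddMonoidHom.id M) (DistribSMul.toAddMonoidHom N d) _ _) x y
    induction x using BT.induction with
    | zero => exact map_zero (map R (AddMonoidHom.id M) (DistribSMul.toAddMonoidHom N 0) _ _)
    | tmul m n => rw [right_smul_tmul, zero_smul]; exact map_zero (mk R m)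
    | add x y hx hy => rw [h, hx, hy, add_zero]

end Right

section Left

variable {A M N : Type u} [Ring A] [AddCommGroup M] [AddCommGroup N] [Module A M] [Module Aᵐᵒᵖ M]
  [SMulCommClass A Aᵐᵒᵖ M] [SMul A N]

/-- If `M` is an `A`-bimodule then `A` acts on `M ⊗_A N` from the left, through `M`. -/
instance leftSMul : SMul A (BT A M N) where
  smul a := map A (DistribSMul.toAddMonoidHom M a) (AddMonoidHom.id N)
    (fun b m => smul_comm a (op b) m) (fun _ _ => rfl)

@[simp] theorem left_smul_tmul (a : A) (m : M) (n : N) :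
    a • tmul A m n = tmul A (a • m) n := rfl

end Left

section Assoc

variable (A : Type u) {M N Q : Type u} [Ring A] [AddCommGroup M] [AddCommGroup N] [AddCommGroup Q]
  [Module Aᵐᵒᵖ M] [Module A N] [Module Aᵐᵒᵖ N] [SMulCommClass A Aᵐᵒᵖ N] [Module A Q]

/-- The map `m ⊗ n ↦ (q ↦ m ⊗ (n ⊗ q))`. -/
def assocAux : BT A M N →+ Q →+ BT A M (BT A N Q) :=
  lift A
    (AddMonoidHom.mk' (fun m => AddMonoidHom.mk' (fun n => (mk A m).comp (mk A n))
      (fun n n' => by ext q; simp [tmul_add]))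
      (fun m m' => by ext n q; simp))
    (fun m a n => by ext q; simp [smul_tmul])

theorem assocAux_tmul (m : M) (n : N) (q : Q) :
    assocAux A (tmul A m n) q = tmul A m (tmul A n q) := rfl

/-- The canonical map `(M ⊗_A N) ⊗_A Q → M ⊗_A (N ⊗_A Q)`, `(m ⊗ n) ⊗ q ↦ m ⊗ (n ⊗ q)`. -/
def assoc : BT A (BT A M N) Q →+ BT A M (BT A N Q) :=
  lift A (assocAux A) (fun x a q => by
    induction x using BT.induction with
    | zero => rw [smul_zero, map_zero]; rfl
    | tmul m n => rw [right_smul_tmul, assocAux_tmul, assocAux_tmul, smul_tmul]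
    | add x y hx hy =>
      rw [smul_add, map_add, map_add, AddMonoidHom.add_apply, AddMonoidHom.add_apply, hx, hy])

@[simp] theorem assoc_tmul (m : M) (n : N) (q : Q) :
    assoc A (tmul A (tmul A m n) q) = tmul A m (tmul A n q) := rfl

end Assoc

end BT

/-! ## Corings and comodules -/

/-- An `A`-coring structure on the (unital) `A`-bimodule `C`. -/
class Coring (A C : Type u) [Ring A] [AddCommGroup C] [Module A C] [Module Aᵐᵒᵖ C]
    [SMulCommClass A Aᵐᵒᵖ C] where
  /-- the comultiplication `Δ : C → C ⊗_A C` -/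
  comul : C →+ BT A C C
  comul_left : ∀ (a : A) (c : C), comul (a • c) = a • comul c
  comul_right : ∀ (a : A) (c : C), comul (op a • c) = op a • comul c
  /-- the counit `ε : C → A` -/
  counit : C →+ A
  counit_left : ∀ (a : A) (c : C), counit (a • c) = a * counit c
  counit_right : ∀ (a : A) (c : C), counit (op a • c) = counit c * a
  /-- `(C ⊗ Δ) ∘ Δ = (Δ ⊗ C) ∘ Δ` -/
  coassoc : ∀ c : C,
    BT.assoc A (BT.map A comul (AddMonoidHom.id C) comul_right (fun _ _ => rfl) (comul c)) =
      BT.map A (AddMonoidHom.id C) comul (fun _ _ => rfl) comul_left (comul c)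
  /-- `(ε ⊗ C) ∘ Δ = C`, up to `A ⊗_A C ≅ C` -/
  counit_comul : ∀ c : C,
    BT.lift A (((AddMonoidHom.smul : A →+ C →+ C)).comp counit)
      (fun c a d => by simp [counit_right, mul_smul]) (comul c) = c
  /-- `(C ⊗ ε) ∘ Δ = C`, up to `C ⊗_A A ≅ C` -/
  comul_counit : ∀ c : C,
    BT.lift A (((AddMonoidHom.smul : Aᵐᵒᵖ →+ C →+ C).comp
        (opAddEquiv.toAddMonoidHom.comp counit)).flip)
      (fun c a d => by simp [counit_left, mul_smul]) (comul c) = c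

/-- A right `C`-comodule structure on the right `A`-module `P`, for an `A`-coring `C`. -/
class RightComodule (A C P : Type u) [Ring A] [AddCommGroup C] [Module A C] [Module Aᵐᵒᵖ C]
    [SMulCommClass A Aᵐᵒᵖ C] [Coring A C] [AddCommGroup P] [Module Aᵐᵒᵖ P] where
  /-- the coaction `ρ : P → P ⊗_A C` -/
  coact : P →+ BT A P C
  coact_right : ∀ (a : A) (u : P), coact (op a • u) = op a • coact u
  /-- `(ρ ⊗ C) ∘ ρ = (P ⊗ Δ) ∘ ρ` -/
  coassoc : ∀ u : P,
    BT.assoc A (BT.map A coact (AddMonoidHom.id C) coact_right (fun _ _ => rfl) (coact u)) =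
      BT.map A (AddMonoidHom.id P) (Coring.comul (A := A)) (fun _ _ => rfl) Coring.comul_left (coact u)
  /-- `(P ⊗ ε) ∘ ρ = P`, up to `P ⊗_A A ≅ P` -/
  coact_counit : ∀ u : P,
    BT.lift A (((AddMonoidHom.smul : Aᵐᵒᵖ →+ P →+ P).comp
        (opAddEquiv.toAddMonoidHom.comp (Coring.counit (A := A) (C := C)))).flip)
      (fun u a c => by simp [Coring.counit_left, mul_smul]) (coact u) = u

section RTensor

variable (A C : Type u) {P M : Type u} [Ring A] [AddCommGroup C] [Module A C] [AddCommGroup P]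
  [Module Aᵐᵒᵖ P] [AddCommGroup M] [Module Aᵐᵒᵖ M]

/-- For a right `A`-linear `f : P → M`, the map `f ⊗_A C : P ⊗_A C → M ⊗_A C`. -/
def rTensor (f : P →ₗ[Aᵐᵒᵖ] M) : BT A P C →+ BT A M C :=
  BT.map A f.toAddMonoidHom (AddMonoidHom.id C) (fun a u => f.map_smul (op a) u) (fun _ _ => rfl)

@[simp] theorem rTensor_tmul (f : P →ₗ[Aᵐᵒᵖ] M) (u : P) (c : C) :
    rTensor A C f (BT.tmul A u c) = BT.tmul A (f u) c := rfl

end RTensor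

section Comodule

variable (A C P : Type u) [Ring A] [AddCommGroup C] [Module A C] [Module Aᵐᵒᵖ C]
  [SMulCommClass A Aᵐᵒᵖ C] [Coring A C] [AddCommGroup P] [Module Aᵐᵒᵖ P] [RightComodule A C P]

/-- The right `A`-linear endomorphism `f` of the comodule `P` is `C`-colinear:
`ρ ∘ f = (f ⊗_A C) ∘ ρ`. -/
def IsColinear (f : P →ₗ[Aᵐᵒᵖ] P) : Prop :=
  ∀ u : P, RightComodule.coact (A := A) (C := C) (f u) =
    rTensor A C f (RightComodule.coact (A := A) (C := C) u)

/-- The ring `T = End^C(P)` of right `C`-colinear endomorphisms of `P`, with composition as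
multiplication. It acts on `P` from the left by evaluation. -/
def ComoduleEnd : Subring (Module.End Aᵐᵒᵖ P) where
  carrier := {f | IsColinear A C P f}
  one_mem' u := by
    change RightComodule.coact (A := A) (C := C) u = _
    generalize RightComodule.coact (A := A) (C := C) u = x
    induction x using BT.induction with
    | zero => rw [map_zero]
    | tmul m n => rfl
    | add x y hx hy => rw [map_add, ← hx, ← hy]
  mul_mem' {f g} hf hg u := by
    rw [Module.End.mul_apply, hf, hg]
    generalize RightComodule.coact (A := A) (C := C) u = x
    induction x using BT.induction with
    | zero => simp only [map_zero]
    | tmul m n => rfl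
    | add x y hx hy => simp only [map_add, hx, hy]
  zero_mem' u := by
    generalize RightComodule.coact (A := A) (C := C) u = x
    rw [LinearMap.zero_apply, map_zero]
    induction x using BT.induction with
    | zero => rw [map_zero]
    | tmul m n => exact (DFunLike.congr_fun (map_zero (BT.mk A (M := P) (N := C))) n).symm
    | add x y hx hy => rw [map_add, ← hx, ← hy, add_zero]
  add_mem' {f g} hf hg u := by
    rw [LinearMap.add_apply, map_add, hf, hg]
    generalize RightComodule.coact (A := A) (C := C) u = x
    induction x using BT.induction with
    | zero => simp only [map_zero, add_zero]
    | tmul m n => simp only [rTensor_tmul, LinearMap.add_apply, BT.add_tmul]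
    | add x y hx hy => simp only [map_add, ← hx, ← hy]; abel
  neg_mem' {f} hf u := by
    rw [LinearMap.neg_apply, map_neg, hf]
    generalize RightComodule.coact (A := A) (C := C) u = x
    induction x using BT.induction with
    | zero => simp only [map_zero, neg_zero]
    | tmul m n =>
      exact (DFunLike.congr_fun (map_neg (BT.mk A (M := P) (N := C)) (f m)) n).symm
    | add x y hx hy => simp only [map_add, ← hx, ← hy]; abel

end Comodule

/-! ## Firm rings, firm modules and bicomodules -/

/-- `M` is a left module over the not necessarily unital ring `R`. -/
class NonUnitalModule (R M : Type u) [NonUnitalRing R] [AddCommGroup M] [SMul R M] : Prop where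
  smul_add : ∀ (r : R) (u v : M), r • (u + v) = r • u + r • v
  add_smul : ∀ (r s : R) (u : M), (r + s) • u = r • u + s • u
  mul_smul : ∀ (r s : R) (u : M), (r * s) • u = r • s • u

instance {R M : Type u} [Ring R] [AddCommGroup M] [Module R M] : NonUnitalModule R M where
  smul_add := _root_.smul_add
  add_smul := _root_.add_smul
  mul_smul := SemigroupAction.mul_smul

instance {R : Type u} [NonUnitalRing R] : NonUnitalModule R R where
  smul_add := mul_add
  add_smul := add_mul
  mul_smul := mul_assoc

/-- The multiplication map `R ⊗_R M → M`, `r ⊗ u ↦ r u`. -/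
def actMap (R M : Type u) [NonUnitalRing R] [AddCommGroup M] [SMul R M] [NonUnitalModule R M] :
    BT R R M →+ M :=
  BT.lift R
    (AddMonoidHom.mk' (fun r => AddMonoidHom.mk' (fun u => r • u) (NonUnitalModule.smul_add r))
      (fun r s => by ext u; exact NonUnitalModule.add_smul r s u))
    (fun r s u => NonUnitalModule.mul_smul r s u)

/-- The left `R`-module `M` is firm: the multiplication map `R ⊗_R M → M` is bijective. -/
def IsFirmModule (R M : Type u) [NonUnitalRing R] [AddCommGroup M] [SMul R M]
    [NonUnitalModule R M] : Prop :=
  Function.Bijective (actMap R M)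

/-- The ring `R` is firm: the multiplication map `R ⊗_R R → R` is bijective. -/
class FirmRing (R : Type u) [NonUnitalRing R] : Prop where
  firm : IsFirmModule R R

/-- Unital modules over unital rings are firm. -/
theorem isFirmModule_of_unital (R M : Type u) [Ring R] [AddCommGroup M] [Module R M] :
    IsFirmModule R M := by
  have key (x : BT R R M) : BT.tmul R (1 : R) (actMap R M x) = x := by
    induction x using BT.induction with
    | zero => rw [map_zero]; exact map_zero (BT.mk R (1 : R))
    | tmul r u =>
      have h := BT.smul_tmul R (1 : R) r u
      rw [op_smul_eq_mul, one_mul] at h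
      exact h.symm
    | add x y hx hy => rw [map_add, BT.tmul_add, hx, hy]
  exact ⟨fun x y h => by rw [← key x, h, key y], fun u => ⟨BT.tmul R 1 u, one_smul R u⟩⟩

instance {R : Type u} [Ring R] : FirmRing R := ⟨isFirmModule_of_unital R R⟩

section Bicomodule

variable (R A C P : Type u) [NonUnitalRing R] [Ring A] [AddCommGroup C] [Module A C]
  [Module Aᵐᵒᵖ C] [SMulCommClass A Aᵐᵒᵖ C] [Coring A C] [AddCommGroup P] [Module Aᵐᵒᵖ P]
  [RightComodule A C P] [SMul R P]

/-- The right `A`-linear map `u ↦ r u` on an `R`-`A`-bimodule `P`. -/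
def leftMul [NonUnitalModule R P] [SMulCommClass R Aᵐᵒᵖ P] (r : R) : P →ₗ[Aᵐᵒᵖ] P where
  toFun u := r • u
  map_add' := NonUnitalModule.smul_add r
  map_smul' a u := smul_comm r a u

/-- `P` is an `R`-`C`-bicomodule, i.e. an object of the category `_R M^C`: the right `C`-comodule
`P` is a firm left `R`-module, the actions of `R` and `A` commute, and the coaction is left
`R`-linear, i.e. `R` acts by right `C`-colinear maps. -/
class FirmBicomodule : Prop extends NonUnitalModule R P, SMulCommClass R Aᵐᵒᵖ P where
  firm : IsFirmModule R P
  colinear : ∀ r : R, IsColinear A C P (leftMul R A P r)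

/-- `P` is a bicomodule over its endomorphism ring `T = End^C(P)`. -/
instance : FirmBicomodule (ComoduleEnd A C P) A C P where
  smul_comm f a u := f.1.map_smul a u
  firm := isFirmModule_of_unital _ _
  colinear f := f.2

/-- The canonical ring morphism `R → T = End^C(P)`, `r ↦ (u ↦ r u)`. -/
def toComoduleEnd [FirmBicomodule R A C P] : R →ₙ+* ComoduleEnd A C P where
  toFun r := ⟨leftMul R A P r, FirmBicomodule.colinear r⟩
  map_zero' := by
    ext u
    have h := NonUnitalModule.add_smul (0 : R) 0 u
    rw [add_zero] at h
    exact left_eq_add.1 h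
  map_add' r s := by ext u; exact NonUnitalModule.add_smul r s u
  map_mul' r s := by ext u; exact NonUnitalModule.mul_smul r s u

/-- `R` is a left ideal in `T = End^C(P)`: the image of the canonical morphism `R → T` is one.
(In Mathlib an `Ideal` of a non-commutative ring is a left ideal.) -/
def IsLeftIdealInEnd [FirmBicomodule R A C P] : Prop :=
  ∃ I : Ideal (ComoduleEnd A C P), (I : Set (ComoduleEnd A C P)) = Set.range (toComoduleEnd R A C P)

end Bicomodule

/-! ## Comonadic-Galois comodules -/

/-- `Hom_A(P, M)`, the right `A`-linear maps. -/
def RHom (A P M : Type u) [Ring A] [AddCommGroup P] [Module Aᵐᵒᵖ P] [AddCommGroup M]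
    [Module Aᵐᵒᵖ M] : Type u :=
  P →ₗ[Aᵐᵒᵖ] M

/-- An element of `Hom_A(P, M)` as a linear map. -/
def RHom.toLinear {A P M : Type u} [Ring A] [AddCommGroup P] [Module Aᵐᵒᵖ P] [AddCommGroup M]
    [Module Aᵐᵒᵖ M] (f : RHom A P M) : P →ₗ[Aᵐᵒᵖ] M :=
  f

section Galois

variable (R A C P : Type u) [NonUnitalRing R] [Ring A] [AddCommGroup C] [Module A C]
  [Module Aᵐᵒᵖ C] [SMulCommClass A Aᵐᵒᵖ C] [Coring A C] [AddCommGroup P] [Module Aᵐᵒᵖ P]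
  [RightComodule A C P] [SMul R P] (M : Type u) [AddCommGroup M] [Module Aᵐᵒᵖ M]

instance : AddCommGroup (RHom A P M) := inferInstanceAs (AddCommGroup (P →ₗ[Aᵐᵒᵖ] M))

/-- The right action `(f r)(u) = f (r u)` of `R` on `Hom_A(P, M)`. -/
instance [NonUnitalModule R P] [SMulCommClass R Aᵐᵒᵖ P] : SMul Rᵐᵒᵖ (RHom A P M) where
  smul r f := LinearMap.comp f.toLinear (leftMul R A P r.unop)

instance [NonUnitalModule R P] [SMulCommClass R Aᵐᵒᵖ P] : NonUnitalModule Rᵐᵒᵖ (RHom A P M) where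
  smul_add _ _ _ := rfl
  add_smul r s f := LinearMap.ext fun u =>
    (congrArg f.toFun (NonUnitalModule.add_smul r.unop s.unop u)).trans (f.map_add _ _)
  mul_smul r s f := LinearMap.ext fun u =>
    congrArg f.toFun (NonUnitalModule.mul_smul s.unop r.unop u)

variable [FirmBicomodule R A C P]

/-- The canonical map `can_M : Hom_A(P, M) ⊗_R P → M ⊗_A C`, `f ⊗ u ↦ f(u₀) ⊗ u₁`, where
`ρ(u) = u₀ ⊗ u₁`. -/
def can : BT R (RHom A P M) P →ₗ[Aᵐᵒᵖ] BT A M C where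
  toFun := BT.lift R
    (AddMonoidHom.mk'
      (fun f : RHom A P M => (rTensor A C f.toLinear).comp (RightComodule.coact (A := A) (C := C) (P := P)))
      (fun f g => by
        ext u
        simp only [AddMonoidHom.comp_apply, AddMonoidHom.add_apply]
        generalize RightComodule.coact (A := A) (C := C) u = x
        induction x using BT.induction with
        | zero => simp only [map_zero, add_zero]
        | tmul m n => exact BT.add_tmul A _ _ n
        | add x y hx hy => simp only [map_add, hx, hy]; abel))
    (fun f r u => by
      simp only [AddMonoidHom.mk'_apply, AddMonoidHom.comp_apply]
      have h := FirmBicomodule.colinear (A := A) (C := C) r u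
      change _ = rTensor A C f.toLinear (RightComodule.coact (leftMul R A P r u))
      rw [h]
      generalize RightComodule.coact (A := A) (C := C) u = x
      induction x using BT.induction with
      | zero => simp only [map_zero]
      | tmul m n => rfl
      | add x y hx hy => simp only [map_add, hx, hy])
  map_add' := map_add _
  map_smul' a x := by
    have h (f : P →ₗ[Aᵐᵒᵖ] M) (x : BT A P C) : rTensor A C f (a • x) = a • rTensor A C f x := by
      induction x using BT.induction with
      | zero => simp only [smul_zero, map_zero]
      | tmul m n => rfl
      | add x y hx hy => simp only [smul_add, map_add, hx, hy]
    induction x using BT.induction with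
    | zero => simp only [smul_zero, map_zero]
    | tmul f u =>
      have h' := RightComodule.coact_right (C := C) a.unop u
      rw [op_unop] at h'
      change rTensor A C f.toLinear (RightComodule.coact (a • u)) =
        a • rTensor A C f.toLinear (RightComodule.coact u)
      rw [h', h]
    | add x y hx hy => simp only [smul_add, map_add, hx, hy]

/-- The `R`-`C`-bicomodule `P`, for a firm ring `R`, is an `R`-`C` comonadic-Galois comodule: the
natural map `can_M : Hom_A(P, M) ⊗_R P → M ⊗_A C` is an isomorphism for every right `A`-module `M`.
For `R = End^C(P)` this is a Galois comodule in the sense of Wisbauer. -/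
def IsComonadicGalois [FirmRing R] : Prop :=
  ∀ (M : Type u) [AddCommGroup M] [Module Aᵐᵒᵖ M], Function.Bijective (can R A C P M)

end Galois

/-! Write `T` for `ComoduleEnd A C P`. The formula `f ⊗ u ↦ f(u₀) ⊗ u₁` does not mention the acting
ring, so for each `M` the map `can` over `R` factors as the canonical map π : Hom_A(P, M) ⊗_R P →
Hom_A(P, M) ⊗_T P followed by `can` over `T`. The map π is always onto, since it only imposes more
relations.

If `can` over `R` is bijective, then π, being the first factor of an injective map, is injective,
hence bijective; cancelling it makes `can` over `T` bijective.

Conversely, bijectivity over `T` passes to `R` as soon as π is injective, that is, as soon as ⊗_R is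
already `T`-balanced. Firmness of `P` reduces this to elements `r u`. When the image of `R` is a
left ideal, `t r` acts on `P` as some `s` in `R`, and the scalar can be moved across ⊗_R: `f t ⊗ r u
= f t r ⊗ u = f s ⊗ u = f ⊗ s u = f ⊗ t (r u)`. -/

section BaseChange

variable (R A C P : Type u) [NonUnitalRing R] [Ring A] [AddCommGroup C] [Module A C]
  [Module Aᵐᵒᵖ C] [SMulCommClass A Aᵐᵒᵖ C] [Coring A C] [AddCommGroup P] [Module Aᵐᵒᵖ P]
  [RightComodule A C P] [SMul R P] [FirmBicomodule R A C P]
  (M : Type u) [AddCommGroup M] [Module Aᵐᵒᵖ M]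

/-- The canonical map `Hom_A(P, M) ⊗_R P → Hom_A(P, M) ⊗_T P` for `T = End^C(P)`. -/
def toEndTensor : BT R (RHom A P M) P →+ BT (ComoduleEnd A C P) (RHom A P M) P :=
  BT.lift R (BT.mk (ComoduleEnd A C P)) fun f r u =>
    -- On both factors `r` acts, by definition, as its image in `T`, so each `R`-relation is a
    -- `T`-relation.
    BT.smul_tmul (ComoduleEnd A C P) f (toComoduleEnd R A C P r) u

@[simp] theorem toEndTensor_tmul (f : RHom A P M) (u : P) :
    toEndTensor R A C P M (BT.tmul R f u) = BT.tmul (ComoduleEnd A C P) f u := rfl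

theorem toEndTensor_surjective : Function.Surjective (toEndTensor R A C P M) := by
  intro x
  induction x using BT.induction with
  | zero => exact ⟨0, map_zero _⟩
  | tmul f u => exact ⟨BT.tmul R f u, rfl⟩
  | add x y hx hy =>
    obtain ⟨x, rfl⟩ := hx
    obtain ⟨y, rfl⟩ := hy
    exact ⟨x + y, map_add _ x y⟩

theorem can_comp_toEndTensor :
    can (ComoduleEnd A C P) A C P M ∘ toEndTensor R A C P M = can R A C P M := by
  ext x
  simp only [Function.comp_apply]
  induction x using BT.induction with
  | zero => simp only [map_zero]
  | tmul f u => rfl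
  | add x y hx hy => simp only [map_add, hx, hy]

/-! ### The left ideal case: tensoring over `R` and over `T` agree -/

variable {R A C P M}

/-- If `R` is a left ideal in `T = End^C(P)`, then `⊗_R` is `T`-balanced on `Hom_A(P, M) × P`. -/
theorem IsLeftIdealInEnd.smul_tmul (h : IsLeftIdealInEnd R A C P) (f : RHom A P M)
    (t : ComoduleEnd A C P) (u : P) :
    BT.tmul R (op t • f) u = BT.tmul R f (t • u) := by
  obtain ⟨I, hI⟩ := h
  -- Surjectivity of `R ⊗_R P → P` writes `u` as a sum of elements `r u'`; both sides are additive
  -- in `u`.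
  obtain ⟨x, rfl⟩ := (FirmBicomodule.firm (R := R) (A := A) (C := C) (P := P)).2 u
  induction x using BT.induction with
  | zero =>
    rw [map_zero, smul_zero]
    exact (map_zero (BT.mk R (op t • f))).trans (map_zero (BT.mk R f)).symm
  | tmul r u =>
    have hr : toComoduleEnd R A C P r ∈ I := by
      rw [← SetLike.mem_coe, hI]
      exact ⟨r, rfl⟩
    have htr := I.mul_mem_left t hr
    rw [← SetLike.mem_coe, hI] at htr
    obtain ⟨s, hs⟩ := htr
    -- Since `R → T` may fail to be injective, `s` need not be unique; only its action on `P`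
    -- enters, and through it the action on Hom_A(P, M).
    have hsv (v : P) : s • v = t • r • v :=
      congrArg (fun g : ComoduleEnd A C P => g.1 v) hs
    have hf : op r • op t • f = op s • f :=
      LinearMap.ext fun v => congrArg f.toLinear (hsv v).symm
    change BT.tmul R (op t • f) (r • u) = BT.tmul R f (t • r • u)
    -- Move `r` to the left, absorb `t r` into `s`, then move `s` back to the right.
    rw [← BT.smul_tmul, hf, BT.smul_tmul, hsv]
  | add x y hx hy => rw [map_add, smul_add, BT.tmul_add, BT.tmul_add, hx, hy]

/-- Because ⊗_R is `T`-balanced, `f ⊗_T u ↦ f ⊗_R u` is well defined, and it is a left inverse. -/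
theorem IsLeftIdealInEnd.toEndTensor_injective (h : IsLeftIdealInEnd R A C P) :
    Function.Injective (toEndTensor R A C P M) := by
  refine Function.LeftInverse.injective
    (g := BT.lift (ComoduleEnd A C P) (BT.mk R) h.smul_tmul) fun x => ?_
  induction x using BT.induction with
  | zero => simp only [map_zero]
  | tmul f u => rfl
  | add x y hx hy => simp only [map_add, hx, hy]

/-! ### Transfer of the Galois property between `R` and `T` -/

theorem IsComonadicGalois.comoduleEnd [FirmRing R] (h : IsComonadicGalois R A C P) :
    IsComonadicGalois (ComoduleEnd A C P) A C P := by
  intro M _ _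
  have hM := h M
  rw [← can_comp_toEndTensor] at hM
  -- Injectivity of the composite gives injectivity of its first factor, so that factor is bijective
  -- and cancels.
  exact (Function.Bijective.of_comp_iff _
    ⟨hM.injective.of_comp, toEndTensor_surjective R A C P M⟩).1 hM

theorem IsLeftIdealInEnd.isComonadicGalois [FirmRing R] (hI : IsLeftIdealInEnd R A C P)
    (h : IsComonadicGalois (ComoduleEnd A C P) A C P) : IsComonadicGalois R A C P := by
  intro M _ _
  rw [← can_comp_toEndTensor]
  exact (h M).comp ⟨hI.toEndTensor_injective, toEndTensor_surjective R A C P M⟩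

end BaseChange

theorem theorem4p3 {A C R P : Type u}
    [Ring A]
    -- `C` is an `A`-coring
    [AddCommGroup C] [Module A C] [Module Aᵐᵒᵖ C] [SMulCommClass A Aᵐᵒᵖ C] [Coring A C]
    -- `R` is a firm ring
    [NonUnitalRing R] [FirmRing R]
    -- `P` (the comodule `Σ` of the text) is an object of `_R M^C`
    [AddCommGroup P] [Module Aᵐᵒᵖ P] [RightComodule A C P] [SMul R P] [FirmBicomodule R A C P] :
    (IsComonadicGalois R A C P → IsComonadicGalois (ComoduleEnd A C P) A C P) ∧
      (IsLeftIdealInEnd R A C P →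
        (IsComonadicGalois R A C P ↔ IsComonadicGalois (ComoduleEnd A C P) A C P)) := by
  exact ⟨fun h => h.comoduleEnd, fun hI => ⟨fun h => h.comoduleEnd, hI.isComonadicGalois⟩⟩
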